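/- **Proposition.** Infinite words are indexed by $\mathbb N=\{0,1,2,\dots\}$, and $\mathcal L(x)$ denotes the set of finite factors (blocks of consecutive letters) of an infinite word $x$. Two finite words are abelian equivalent, $u\sim_{\mathrm{ab}}v$, if every letter occurs equally often in both. For $x\in\Sigma^{\mathbb N}$ put $$\mathcal A(x)=\{y\in\Sigma^{\mathbb N}:\ \forall u\in\mathcal L(y)\ \exists v\in\mathcal L(x),\ u\sim_{\mathrm{ab}}v\},\qquad \Omega(x)=\{y\in\Sigma^{\mathbb N}:\ \mathcal L(y)\subseteq\mathcal L(x)\}$$ (the abelian closure and the shift orbit closure of $x$). A subshift is a nonempty subset of $\Sigma^{\mathbb N}$ that is closed in the product topology ($\Sigma$ being discrete) and is mapped into itself by the shift $a_0a_1a_2\cdots\mapsto a_1a_2\cdots$; it is minimal if it contains no subshift other than itself. An infinite word is periodic if it is of the form $v^\omega=vvv\cdots$ with $v$ a nonempty finite word. A Sturmian word is a rotation word of irrational slope: a word $s\in\{0,1\}^{\mathbb N}$ for which there are an irrational $\alpha\in[0,1)$ and $\rho\in[0,1)$ such that either, for all $n$, $s_n=1$ iff $\{\rho+n\alpha\}\in[1-\alpha,1)$,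 or, for all $n$, $s_n=1$ iff $\{\rho+n\alpha\}\in(1-\alpha,1)\cup\{0\}$, where $\{\cdot\}$ is the fractional part. For a binary word $s$ and infinite words $z_0,z_1$, let $\mathcal S(s,z_0,z_1)$ be the word obtained from $s$ by replacing, for every $n$, the $n$-th occurrence of $0$ (resp. $1$) in $s$ by the $n$-th letter of $z_0$ (resp. $z_1$). Let $A,B\subseteq\Sigma$ be disjoint alphabets, let $s$ be a Sturmian word, let $z_0\in A^{\mathbb N}$ and $z_1\in B^{\mathbb N}$ be periodic words, and let $u=\mathcal S(s,z_0,z_1)$. Then $$\mathcal A(u)=\bigcup_{t_0\in\mathcal A(z_0),\ t_1\in\mathcal A(z_1)}\Omega\big(\mathcal S(s,t_0,t_1)\big),$$ and $\mathcal A(u)$ is a union of finitely many minimal subshifts. -/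

import Mathlib

noncomputable section

namespace InfWord

/-- The block `x_i x_{i+1} ⋯ x_{i+n-1}` of length `n` of the infinite word `x`. -/
def block {α : Type*} (x : ℕ → α) (i n : ℕ) : List α :=
  List.ofFn (fun k : Fin n => x (i + k))

/-- The set of (finite) factors of the infinite word `x`. -/
def language {α : Type*} (x : ℕ → α) : Set (List α) :=
  {w | ∃ i n : ℕ, w = block x i n}

/-- Two finite words are abelian equivalent if each letter occurs equally often in both. -/
def AbelianEquiv {α : Type*} (u v : List α) : Prop :=
  open Classical in ∀ a : α, u.count a = v.count a

theorem abelianEquiv_iff_perm {α : Type*} (u v : List α) : AbelianEquiv u v ↔ u.Perm v := by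
  classical
  rw [List.perm_iff_count]
  unfold AbelianEquiv
  constructor
  · intro h a
    convert h a
  · intro h a
    convert h a

/-- The abelian closure of the infinite word `x`: all infinite words `y` each of whose factors
is abelian equivalent to some factor of `x`. -/
def abelianClosure {α : Type*} (x : ℕ → α) : Set (ℕ → α) :=
  {y | ∀ u ∈ language y, ∃ v ∈ language x, AbelianEquiv u v}

/-- The shift orbit closure of the infinite word `x`: all infinite words `y` each of whose
factors is a factor of `x`. -/
def orbitClosure {α : Type*} (x : ℕ → α) : Set (ℕ → α) :=
  {y | language y ⊆ language x}

/-- The shift operator, deleting the first letter. -/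
def shift {α : Type*} (x : ℕ → α) : ℕ → α := fun n => x (n + 1)

/-- A subshift: a nonempty, closed (for the product topology) set of infinite words that the
shift operator maps into itself. -/
structure IsSubshift {α : Type*} [TopologicalSpace α] (X : Set (ℕ → α)) : Prop where
  nonempty : X.Nonempty
  isClosed : IsClosed X
  shift_mem : ∀ x ∈ X, shift x ∈ X

/-- A minimal subshift: a subshift that contains no subshift other than itself. -/
def IsMinimalSubshift {α : Type*} [TopologicalSpace α] (X : Set (ℕ → α)) : Prop :=
  IsSubshift X ∧ ∀ Y : Set (ℕ → α), IsSubshift Y → Y ⊆ X → Y = X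

/-- A periodic infinite word `v^ω` with `v` a nonempty finite word. -/
def IsPeriodic {α : Type*} (x : ℕ → α) : Prop :=
  ∃ p : ℕ, 0 < p ∧ Function.Periodic x p

/-- The rotation word of slope `a` and intercept `r` for the partition of the circle into
`[0, 1 - a)` (letter `0`) and `[1 - a, 1)` (letter `1`); the `n`-th point of the orbit of `r`
under the rotation by `a` is the fractional part of `r + n * a`. -/
def lowerRotationWord (a r : ℝ) : ℕ → Fin 2 := fun n =>
  if 1 - a ≤ Int.fract (r + n * a) then 1 else 0

/-- The rotation word of slope `a` and intercept `r` for the partition of the circle into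
`(0, 1 - a]` (letter `0`) and `(1 - a, 1]` (letter `1`); the endpoint `1` is the point `0`
of the circle. -/
def upperRotationWord (a r : ℝ) : ℕ → Fin 2 := fun n =>
  if 1 - a < Int.fract (r + n * a) ∨ Int.fract (r + n * a) = 0 then 1 else 0

/-- A Sturmian word: a rotation word of irrational slope (equivalently, an aperiodic rotation
word), for either choice of the endpoints. -/
def IsSturmian (s : ℕ → Fin 2) : Prop :=
  ∃ a r : ℝ, Irrational a ∧ a ∈ Set.Ico (0 : ℝ) 1 ∧ r ∈ Set.Ico (0 : ℝ) 1 ∧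
    (s = lowerRotationWord a r ∨ s = upperRotationWord a r)

/-- The word obtained from the binary word `x` by replacing the `n`-th occurrence of `0`
by the `n`-th letter of `z₀` and the `n`-th occurrence of `1` by the `n`-th letter of `z₁`. -/
def substitute {α : Type*} (x : ℕ → Fin 2) (z₀ z₁ : ℕ → α) : ℕ → α := fun n =>
  if x n = 0 then z₀ (Nat.count (fun i => x i = 0) n)
  else z₁ (Nat.count (fun i => x i = 1) n)

end InfWord

end

/-! The proof rests on one equidistribution fact. A Sturmian word `s` of slope `a` has prefix counts
of ones in a unit strip around a line of slope `a`. Hence any pattern of increments that is strictly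
balanced with respect to `a` is realised in `s` at positions `j` where `b + j * a` lies in a
suitable open interval. Since `a` is irrational, such `j` occur with bounded gaps, even with `j` and
the number of ones before `j` prescribed modulo `N` (`HasSlope.exists_occurrence`).

Take `N` a common period of `z₀` and `z₁`. A factor of a substituted word is then fixed by a factor
of `s` and the two residues where reading starts in the periodic words. As all residues occur with
every factor of `s`, abelian changes of `z₀` and `z₁` can be made independently, which gives one
inclusion. Conversely, disjoint alphabets let a word of the abelian closure be unshuffled into a
binary word, again balanced with slope `a`, and two words abelian-close to `z₀` and `z₁`.

Bounded gaps yield minimality. Finiteness holds because the abelian closure of an `N`-periodic word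
consists of `N`-periodic words over a finite alphabet. -/

noncomputable section

namespace InfWord

/-! ### Letter counts, irrational rotations and slopes -/

/-- The number of occurrences of the letter `b` among the first `n` letters of `x`. -/
def letterCount (x : ℕ → Fin 2) (b : Fin 2) (n : ℕ) : ℕ := Nat.count (fun i => x i = b) n

theorem letterCount_succ (x : ℕ → Fin 2) (b : Fin 2) (n : ℕ) :
    letterCount x b (n + 1) = letterCount x b n + if x n = b then 1 else 0 :=
  Nat.count_succ _ n

@[simp] theorem letterCount_zero (x : ℕ → Fin 2) (b : Fin 2) : letterCount x b 0 = 0 :=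
  Nat.count_zero _

theorem letterCount_zero_add_one (x : ℕ → Fin 2) (n : ℕ) :
    letterCount x 0 n + letterCount x 1 n = n := by
  induction n with
  | zero => simp
  | succ n ih =>
    rw [letterCount_succ, letterCount_succ]
    have : x n = 0 ∨ x n = 1 := by omega
    rcases this with h | h <;> simp [h] <;> omega

/-- The orbits of an irrational rotation enter a given arc in uniformly bounded time. -/
theorem exists_uniform_hitting_time {a c d : ℝ} (ha : Irrational a) (hcd : c < d) :
    ∃ L : ℕ, ∀ θ : ℝ, ∃ t : ℕ, t < L ∧ ∃ z : ℤ, c < θ + t * a - z ∧ θ + t * a - z < d := by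
  -- In the compact circle group, the natural multiples of an element have the same closure as its
  -- integer multiples.
  have hd : Dense (Set.range (fun n : ℕ => n • (a : AddCircle (1 : ℝ)))) := by
    have h := (AddCircle.denseRange_zsmul_coe_iff (a := a) (p := 1)).2 (by simpa using ha)
    intro x
    exact ((mapClusterPt_atTop_nsmul_tfae x (a : AddCircle (1 : ℝ))).out 2 3).2 (h x)
  let U : Set (AddCircle (1 : ℝ)) := QuotientAddGroup.mk '' Set.Ioo c d
  have hU : IsOpen U := QuotientAddGroup.isOpenMap_coe _ isOpen_Ioo
  have hUne : U.Nonempty := (Set.nonempty_Ioo.2 hcd).image _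
  let V : ℕ → Set (AddCircle (1 : ℝ)) := fun t => {θ | θ + t • (a : AddCircle (1 : ℝ)) ∈ U}
  have hV : ∀ t, IsOpen (V t) := fun t => hU.preimage (by fun_prop)
  have hcov : Set.univ ⊆ ⋃ t, V t := by
    intro θ _
    have hne : ((fun w => θ + w) ⁻¹' U).Nonempty := by
      obtain ⟨u, hu⟩ := hUne
      exact ⟨u - θ, by simpa using hu⟩
    obtain ⟨_, hw, t, rfl⟩ := hd.inter_open_nonempty _ (hU.preimage (by fun_prop)) hne
    exact Set.mem_iUnion.2 ⟨t, hw⟩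
  obtain ⟨S, hS⟩ := isCompact_univ.elim_finite_subcover V hV hcov
  refine ⟨S.sup id + 1, fun θ => ?_⟩
  obtain ⟨t, htS, w, hw, hwe⟩ : ∃ t ∈ S, (θ : AddCircle (1 : ℝ)) ∈ V t := by
    simpa using hS (Set.mem_univ (θ : AddCircle (1 : ℝ)))
  refine ⟨t, Nat.lt_succ_of_le (Finset.le_sup (f := id) htS), ?_⟩
  have hz : ((θ + t * a - w : ℝ) : AddCircle (1 : ℝ)) = 0 := by
    rw [AddCircle.coe_sub, sub_eq_zero, AddCircle.coe_add, ← nsmul_eq_mul, AddCircle.coe_nsmul]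
    exact hwe.symm
  obtain ⟨z, hz⟩ := (AddCircle.coe_eq_zero_iff (1 : ℝ)).1 hz
  refine ⟨z, ?_, ?_⟩ <;> simp only [zsmul_eq_mul, mul_one] at hz
  · linarith [hw.1]
  · linarith [hw.2]

/-- The number of letters `1` in the prefixes of `s` grows linearly, with slope `a`, and with the
least discrepancy possible. -/
def HasSlope (s : ℕ → Fin 2) (a : ℝ) : Prop :=
  ∃ b : ℝ, ∀ j : ℕ, b + j * a - 1 ≤ (letterCount s 1 j : ℝ) ∧ (letterCount s 1 j : ℝ) ≤ b + j * a

/-- The letter is `1` exactly when adding `a` raises the floor of `r + j * a`, so the count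
telescopes. For the upper word, ceilings play this role. -/
theorem lowerRotationWord_hasSlope {a r : ℝ} (ha : a ∈ Set.Ico (0 : ℝ) 1) :
    HasSlope (lowerRotationWord a r) a := by
  have key : ∀ j : ℕ, (letterCount (lowerRotationWord a r) 1 j : ℤ) = ⌊r + j * a⌋ - ⌊r⌋ := by
    intro j
    induction j with
    | zero => simp
    | succ j ih =>
      have h0 := Int.floor_add_fract (r + j * a)
      have h1 := Int.fract_nonneg (r + j * a)
      have h2 := Int.fract_lt_one (r + j * a)
      have e : r + ((j + 1 : ℕ) : ℝ) * a = r + j * a + a := by push_cast; ring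
      rw [letterCount_succ, e]
      push_cast
      rw [ih]
      by_cases h : 1 - a ≤ Int.fract (r + j * a)
      · have : ⌊r + j * a + a⌋ = ⌊r + j * a⌋ + 1 := by
          rw [Int.floor_eq_iff]; push_cast; constructor <;> linarith [ha.1, ha.2]
        simp [lowerRotationWord, h, this]; ring
      · have : ⌊r + j * a + a⌋ = ⌊r + j * a⌋ := by
          rw [Int.floor_eq_iff]; constructor <;> linarith [ha.1, ha.2]
        simp [lowerRotationWord, h, this]
  refine ⟨r - ⌊r⌋, fun j => ?_⟩
  have h := congrArg (Int.cast : ℤ → ℝ) (key j)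
  push_cast at h
  rw [h]
  constructor <;> linarith [Int.floor_le (r + j * a), Int.lt_floor_add_one (r + j * a)]

theorem upperRotationWord_hasSlope {a r : ℝ} (ha : a ∈ Set.Ico (0 : ℝ) 1) (ha0 : 0 < a) :
    HasSlope (upperRotationWord a r) a := by
  have key : ∀ j : ℕ, (letterCount (upperRotationWord a r) 1 j : ℤ) = ⌈r + j * a⌉ - ⌈r⌉ := by
    intro j
    induction j with
    | zero => simp
    | succ j ih =>
      have h0 := Int.floor_add_fract (r + j * a)
      have h1 := Int.fract_nonneg (r + j * a)
      have h2 := Int.fract_lt_one (r + j * a)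
      have e : r + ((j + 1 : ℕ) : ℝ) * a = r + j * a + a := by push_cast; ring
      rw [letterCount_succ, e]
      push_cast
      rw [ih]
      by_cases hf : Int.fract (r + j * a) = 0
      · have e1 : ⌈r + j * a⌉ = ⌊r + j * a⌋ := by
          rw [Int.ceil_eq_iff]; constructor <;> linarith
        have e2 : ⌈r + j * a + a⌉ = ⌊r + j * a⌋ + 1 := by
          rw [Int.ceil_eq_iff]; push_cast; constructor <;> linarith [ha.1, ha.2]
        simp [upperRotationWord, hf, e1, e2]; ring
      · have h1 : 0 < Int.fract (r + j * a) := lt_of_le_of_ne h1 (Ne.symm hf)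
        have e1 : ⌈r + j * a⌉ = ⌊r + j * a⌋ + 1 := by
          rw [Int.ceil_eq_iff]; push_cast; constructor <;> linarith
        by_cases h : 1 - a < Int.fract (r + j * a)
        · have e2 : ⌈r + j * a + a⌉ = ⌊r + j * a⌋ + 2 := by
            rw [Int.ceil_eq_iff]; push_cast; constructor <;> linarith [ha.1, ha.2]
          simp [upperRotationWord, h, e1, e2]; ring
        · have e2 : ⌈r + j * a + a⌉ = ⌊r + j * a⌋ + 1 := by
            rw [Int.ceil_eq_iff]; push_cast; constructor <;> linarith [ha.1, ha.2]
          simp [upperRotationWord, h, hf, e1, e2]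
  refine ⟨r + 1 - ⌈r⌉, fun j => ?_⟩
  have h := congrArg (Int.cast : ℤ → ℝ) (key j)
  push_cast at h
  rw [h]
  constructor <;> linarith [Int.le_ceil (r + j * a), Int.ceil_lt_add_one (r + j * a)]

theorem IsSturmian.exists_hasSlope {s : ℕ → Fin 2} (hs : IsSturmian s) :
    ∃ a : ℝ, Irrational a ∧ 0 < a ∧ a < 1 ∧ HasSlope s a := by
  obtain ⟨a, r, hirr, ha, -, hs⟩ := hs
  have ha0 : 0 < a := lt_of_le_of_ne ha.1 hirr.ne_zero.symm
  refine ⟨a, hirr, ha0, ha.2, ?_⟩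
  rcases hs with rfl | rfl
  · exact lowerRotationWord_hasSlope ha
  · exact upperRotationWord_hasSlope ha ha0

/-- The strip gives `≤ 1`; equality would make a nonzero integer multiple of `a` an integer.
Strictness is what later leaves an open interval to hit. -/
theorem HasSlope.sub_lt_one {s : ℕ → Fin 2} {a : ℝ} (hs : HasSlope s a) (ha : Irrational a)
    (j k : ℕ) : (letterCount s 1 j : ℝ) - letterCount s 1 k - ((j : ℝ) - k) * a < 1 := by
  obtain ⟨b, hb⟩ := hs
  have h1 := (hb j).2
  have h2 := (hb k).1
  refine lt_of_le_of_ne (by linarith) fun h => ?_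
  rcases eq_or_ne j k with rfl | hjk
  · simp at h
  · refine (ha.intCast_mul (m := (j : ℤ) - k) (by omega)).ne_int
      ((letterCount s 1 j : ℤ) - letterCount s 1 k - 1) ?_
    push_cast
    linarith

/-- A word of slope `a` takes every increment pattern `T 0, …, T n` that is balanced with respect
to `a`, and does so within bounded gaps at positions with prescribed residues. -/
theorem HasSlope.exists_occurrence {s : ℕ → Fin 2} {a : ℝ} (hs : HasSlope s a) (ha : Irrational a)
    {N : ℕ} (hN : 0 < N) (n : ℕ) (T : ℕ → ℕ)
    (hT : ∀ j ≤ n, ∀ k ≤ n, (T j : ℝ) - T k - ((j : ℝ) - k) * a < 1) (x y : ℕ) :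
    ∃ L : ℕ, ∀ m : ℕ, ∃ j, m ≤ j ∧ j < m + L ∧ j ≡ x [MOD N] ∧
      letterCount s 1 j ≡ y [MOD N] ∧
      ∀ k ≤ n, letterCount s 1 (j + k) + T 0 = T k + letterCount s 1 j := by
  obtain ⟨b, hb⟩ := hs
  -- Deviation of the pattern from the line of slope `a`. It suffices that `b + j * a - N * z` lies
  -- strictly between `max f + y` and `min f + 1 + y`, an interval that balance makes nonempty.
  let f : ℕ → ℝ := fun k => (T k : ℝ) - T 0 - k * a
  obtain ⟨k₁, hk₁, hmax⟩ := Finset.exists_max_image (Finset.range (n + 1)) f ⟨0, by simp⟩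
  obtain ⟨k₂, hk₂, hmin⟩ := Finset.exists_min_image (Finset.range (n + 1)) f ⟨0, by simp⟩
  simp only [Finset.mem_range, Nat.lt_succ_iff] at hk₁ hk₂ hmax hmin
  have hcd : f k₁ < f k₂ + 1 := by
    have := hT k₁ hk₁ k₂ hk₂
    simp only [f]
    linarith
  have hN' : (0 : ℝ) < N := by exact_mod_cast hN
  -- After division by `N`, moving `j` by `N` is rotation by `a` on the unit circle, and the integer
  -- `z` found there records a multiple of `N` in the count.
  obtain ⟨L, hL⟩ := exists_uniform_hitting_time (c := (f k₁ + y) / N) (d := (f k₂ + 1 + y) / N) ha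
    (by gcongr)
  refine ⟨x + N + N * L + 1, fun m => ?_⟩
  obtain ⟨t, htL, z, hz₁, hz₂⟩ := hL ((b + (x + N * (m / N + 1) : ℕ) * a) / N)
  have hdiv := Nat.div_add_mod m N
  have hmod := Nat.mod_lt m hN
  have htL' : N * t ≤ N * L := Nat.mul_le_mul_left _ htL.le
  set q := m / N
  -- The summand `N * (q + 1)` exceeds `m` by at most `N`, which keeps the gap bound independent of
  -- `m`.
  set j := x + N * (q + 1) + N * t with hj
  rw [div_lt_iff₀ hN'] at hz₁
  rw [lt_div_iff₀ hN'] at hz₂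
  have hmul : ((b + (x + N * (q + 1) : ℕ) * a) / N + t * a - z) * N = b + j * a - N * z := by
    rw [hj]; push_cast; field_simp; ring
  rw [hmul] at hz₁ hz₂
  have hcount : ∀ k ≤ n, (letterCount s 1 (j + k) : ℤ) = N * z + y + T k - T 0 := by
    intro k hk
    have h1 := hmax k hk
    have h2 := hmin k hk
    have hbk := hb (j + k)
    simp only [f] at h1 h2 hz₁ hz₂
    push_cast at hbk
    have u1 : (letterCount s 1 (j + k) : ℝ) < ((N * z + y + T k - T 0 + 1 : ℤ) : ℝ) := by
      push_cast; linarith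
    have u2 : ((N * z + y + T k - T 0 - 1 : ℤ) : ℝ) < (letterCount s 1 (j + k) : ℝ) := by
      push_cast; linarith
    have u1' : (letterCount s 1 (j + k) : ℤ) < N * z + y + T k - T 0 + 1 := by exact_mod_cast u1
    have u2' : N * z + y + T k - T 0 - 1 < (letterCount s 1 (j + k) : ℤ) := by exact_mod_cast u2
    omega
  have h0 := hcount 0 (Nat.zero_le _)
  simp only [add_zero] at h0
  have hNq : N * (q + 1) = N * q + N := by ring
  refine ⟨j, by omega, by omega, ?_, ?_, fun k hk => ?_⟩
  · rw [hj, add_assoc, ← Nat.mul_add]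
    simp [Nat.ModEq]
  · rw [← Int.natCast_modEq_iff, h0]
    refine Int.ModEq.symm ((Int.modEq_iff_dvd).2 ⟨z, by ring⟩)
  · have := hcount k hk
    omega

/-! ### Factors, shuffles and residues -/

variable {α : Type*}

@[simp] theorem length_block (x : ℕ → α) (i n : ℕ) : (block x i n).length = n := by
  simp [block]

theorem block_succ (x : ℕ → α) (i n : ℕ) : block x i (n + 1) = block x i n ++ [x (i + n)] := by
  rw [block, List.ofFn_succ_last]
  simp [block]

theorem block_succ' (x : ℕ → α) (i n : ℕ) : block x i (n + 1) = x i :: block x (i + 1) n := by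
  simp [block, List.ofFn_succ, Nat.add_assoc, Nat.add_comm 1]

@[simp] theorem block_zero (x : ℕ → α) (i : ℕ) : block x i 0 = [] := by simp [block]

theorem block_eq_block_iff {x y : ℕ → α} {i j n : ℕ} :
    block x i n = block y j n ↔ ∀ k < n, x (i + k) = y (j + k) := by
  rw [block, block, List.ofFn_inj, funext_iff, Fin.forall_iff]

theorem mem_block {x : ℕ → α} {i n : ℕ} {c : α} : c ∈ block x i n ↔ ∃ k < n, x (i + k) = c := by
  simp [block, List.mem_ofFn, Fin.exists_iff]

theorem map_block {β : Type*} (f : α → β) (x : ℕ → α) (i n : ℕ) :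
    (block x i n).map f = block (f ∘ x) i n := by
  simp [block, List.map_ofFn, Function.comp_def]

theorem mem_abelianClosure_iff {x y : ℕ → α} :
    y ∈ abelianClosure x ↔ ∀ i n, ∃ j, (block y i n).Perm (block x j n) := by
  constructor
  · intro h i n
    obtain ⟨v, ⟨j, m, rfl⟩, hv⟩ := h _ ⟨i, n, rfl⟩
    rw [abelianEquiv_iff_perm] at hv
    have hl := hv.length_eq
    simp only [length_block] at hl
    subst hl
    exact ⟨j, hv⟩
  · rintro h _ ⟨i, n, rfl⟩
    obtain ⟨j, hj⟩ := h i n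
    exact ⟨_, ⟨j, n, rfl⟩, (abelianEquiv_iff_perm _ _).2 hj⟩

theorem mem_orbitClosure_iff {x y : ℕ → α} :
    y ∈ orbitClosure x ↔ ∀ i n, ∃ j, block y i n = block x j n := by
  constructor
  · intro h i n
    obtain ⟨j, m, hj⟩ := h ⟨i, n, rfl⟩
    have hl := congrArg List.length hj
    simp only [length_block] at hl
    subst hl
    exact ⟨j, hj⟩
  · rintro h _ ⟨i, n, rfl⟩
    obtain ⟨j, hj⟩ := h i n
    exact ⟨j, n, hj⟩

theorem letterCount_add (x : ℕ → Fin 2) (b : Fin 2) (i n : ℕ) :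
    letterCount x b (i + n) = letterCount x b i + (block x i n).count b := by
  induction n with
  | zero => simp
  | succ n ih =>
    rw [← Nat.add_assoc, letterCount_succ, ih, block_succ, List.count_append, List.count_singleton]
    simp [Nat.add_assoc]

/-- The factors of `substitute x z₀ z₁` are shuffles of factors of `z₀` and `z₁`. -/
theorem block_substitute_perm (x : ℕ → Fin 2) (z₀ z₁ : ℕ → α) (i n : ℕ) :
    (block (substitute x z₀ z₁) i n).Perm
      (block z₀ (letterCount x 0 i) ((block x i n).count 0) ++
        block z₁ (letterCount x 1 i) ((block x i n).count 1)) := by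
  induction n with
  | zero => simp
  | succ n ih =>
    rw [block_succ, block_succ]
    refine (ih.append_right _).trans ?_
    have h0 := letterCount_add x 0 i n
    have h1 := letterCount_add x 1 i n
    have hx : x (i + n) = 0 ∨ x (i + n) = 1 := by omega
    rcases hx with hx | hx
    · have e : substitute x z₀ z₁ (i + n) = z₀ (letterCount x 0 (i + n)) := by
        rw [substitute, if_pos hx]; rfl
      have c0 : (block x i n ++ [x (i + n)]).count 0 = (block x i n).count 0 + 1 := by simp [hx]
      have c1 : (block x i n ++ [x (i + n)]).count 1 = (block x i n).count 1 := by simp [hx]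
      rw [c0, c1, block_succ, e, h0, List.append_assoc, List.append_assoc]
      exact List.perm_append_comm.append_left _
    · have e : substitute x z₀ z₁ (i + n) = z₁ (letterCount x 1 (i + n)) := by
        rw [substitute, if_neg (by simp [hx])]; rfl
      have c0 : (block x i n ++ [x (i + n)]).count 0 = (block x i n).count 0 := by simp [hx]
      have c1 : (block x i n ++ [x (i + n)]).count 1 = (block x i n).count 1 + 1 := by simp [hx]
      rw [c0, c1, block_succ, e, h1, List.append_assoc]

theorem letterCount_zero_modEq {x x' : ℕ → Fin 2} {i j N : ℕ} (h : i ≡ j [MOD N])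
    (h1 : letterCount x 1 i ≡ letterCount x' 1 j [MOD N]) :
    letterCount x 0 i ≡ letterCount x' 0 j [MOD N] := by
  rw [← letterCount_zero_add_one x i, ← letterCount_zero_add_one x' j] at h
  exact Nat.ModEq.add_right_cancel h1 h

theorem block_eq_of_letterCount {x x' : ℕ → Fin 2} {i j n : ℕ}
    (h : ∀ k ≤ n, letterCount x 1 (j + k) + letterCount x' 1 i =
      letterCount x' 1 (i + k) + letterCount x 1 j) :
    block x j n = block x' i n := by
  rw [block_eq_block_iff]
  intro k hk
  have h1 := h k hk.le
  have h2 := h (k + 1) hk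
  rw [← Nat.add_assoc, ← Nat.add_assoc, letterCount_succ, letterCount_succ] at h2
  by_cases c : x (j + k) = 1 <;> by_cases c' : x' (i + k) = 1 <;> simp [c, c'] at h2 <;> omega

theorem block_eq_of_modEq {z : ℕ → α} {N i j : ℕ} (hz : Function.Periodic z N)
    (h : i ≡ j [MOD N]) (n : ℕ) : block z i n = block z j n := by
  rw [block_eq_block_iff]
  intro k _
  rw [← hz.map_mod_nat (i + k), ← hz.map_mod_nat (j + k)]
  exact congrArg z (h.add_right k)

theorem block_substitute_eq {x x' : ℕ → Fin 2} {z₀ z₁ : ℕ → α} {N i j n : ℕ}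
    (hz₀ : Function.Periodic z₀ N) (hz₁ : Function.Periodic z₁ N)
    (h : block x j n = block x' i n) (hij : j ≡ i [MOD N])
    (hc : letterCount x 1 j ≡ letterCount x' 1 i [MOD N]) :
    block (substitute x z₀ z₁) j n = block (substitute x' z₀ z₁) i n := by
  rw [block_eq_block_iff] at h ⊢
  intro k hk
  have hb : block x j k = block x' i k := block_eq_block_iff.2 fun l hl => h l (hl.trans hk)
  have hc0 := letterCount_zero_modEq hij hc
  have g0 : letterCount x 0 (j + k) ≡ letterCount x' 0 (i + k) [MOD N] := by
    rw [letterCount_add, letterCount_add, hb]; exact hc0.add_right _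
  have g1 : letterCount x 1 (j + k) ≡ letterCount x' 1 (i + k) [MOD N] := by
    rw [letterCount_add, letterCount_add, hb]; exact hc.add_right _
  have f0 := block_eq_block_iff.1 (block_eq_of_modEq hz₀ g0 1) 0 one_pos
  have f1 := block_eq_block_iff.1 (block_eq_of_modEq hz₁ g1 1) 0 one_pos
  simp only [letterCount, add_zero] at f0 f1
  simp only [substitute, h k hk, f0, f1]

/-! ### Abelian closures of periodic words -/

theorem block_perm_block {z : ℕ → α} {N : ℕ} (hz : Function.Periodic z N) (i : ℕ) :
    (block z i N).Perm (block z 0 N) := by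
  induction i with
  | zero => rfl
  | succ i ih =>
    refine List.Perm.trans ?_ ih
    refine List.Perm.cons_inv (a := z i) ?_
    rw [← block_succ', block_succ, hz i]
    exact List.perm_append_singleton _ _

/-- All windows of length `N` in `z` are permutations of one another, hence so are those in `y`.
Comparing two consecutive windows equates the letter that leaves with the one that enters. -/
theorem periodic_of_mem_abelianClosure {z y : ℕ → α} {N : ℕ} (hz : Function.Periodic z N)
    (hy : y ∈ abelianClosure z) : Function.Periodic y N := by
  intro i
  rw [mem_abelianClosure_iff] at hy
  obtain ⟨j, hj⟩ := hy i N
  obtain ⟨j', hj'⟩ := hy (i + 1) N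
  have h : (block y i N).Perm (block y (i + 1) N) :=
    (hj.trans (block_perm_block hz j)).trans (hj'.trans (block_perm_block hz j')).symm
  have h2 : (y i :: block y (i + 1) N).Perm (y (i + N) :: block y (i + 1) N) := by
    rw [← block_succ', block_succ]
    exact (List.perm_append_singleton _ _).trans (h.cons _)
  have := h2.symm
  classical
  rw [List.perm_iff_count] at this
  have h3 := this (y i)
  rw [List.count_cons_self, List.count_cons] at h3
  by_contra hne
  simp [hne] at h3

theorem finite_abelianClosure {z : ℕ → α} {N : ℕ} (hN : 0 < N) (hz : Function.Periodic z N) :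
    (abelianClosure z).Finite := by
  have hr : (Set.range z).Finite := by
    refine (Set.finite_range (fun k : Fin N => z k)).subset ?_
    rintro _ ⟨n, rfl⟩
    exact ⟨⟨n % N, Nat.mod_lt _ hN⟩, hz.map_mod_nat n⟩
  have hf : (Set.pi Set.univ fun _ : Fin N => Set.range z).Finite := Set.Finite.pi fun _ => hr
  refine Set.Finite.of_finite_image (f := fun y (k : Fin N) => y k) (hf.subset ?_) ?_
  · rintro _ ⟨y, hy, rfl⟩ k -
    obtain ⟨j, hj⟩ := mem_abelianClosure_iff.1 hy k 1
    exact ⟨j, by simpa [block] using hj.symm⟩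
  · intro y hy y' hy' h
    funext n
    rw [← (periodic_of_mem_abelianClosure hz hy).map_mod_nat n,
      ← (periodic_of_mem_abelianClosure hz hy').map_mod_nat n]
    exact congrFun h ⟨n % N, Nat.mod_lt _ hN⟩

/-! ### Uniform recurrence and minimality -/

theorem iterate_shift_apply (y : ℕ → α) (j n : ℕ) : (shift^[j] y) n = y (j + n) := by
  induction j generalizing y with
  | zero => simp
  | succ j ih =>
    rw [Function.iterate_succ_apply, ih, shift]
    congr 1
    omega

/-- The orbit closure of a uniformly recurrent word is a minimal subshift. -/
theorem isMinimalSubshift_orbitClosure [TopologicalSpace α] [DiscreteTopology α] {v : ℕ → α}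
    (hv : ∀ i n, ∃ L, ∀ m, ∃ j, m ≤ j ∧ j < m + L ∧ block v j n = block v i n) :
    IsMinimalSubshift (orbitClosure v) := by
  refine ⟨⟨⟨v, fun _ h => h⟩, ?_, ?_⟩, ?_⟩
  · have h : orbitClosure v = ⋂ (i : ℕ) (n : ℕ), (fun y (k : Fin n) => y (i + k)) ⁻¹'
        {w : Fin n → α | List.ofFn w ∈ language v} := by
      ext y
      simp only [Set.mem_iInter]
      constructor
      · exact fun h i n => h ⟨i, n, rfl⟩
      · rintro h _ ⟨i, n, rfl⟩
        exact h i n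
    rw [h]
    refine isClosed_iInter fun i => isClosed_iInter fun n => ?_
    exact (isClosed_discrete _).preimage (by fun_prop)
  · intro x hx
    rw [mem_orbitClosure_iff] at hx ⊢
    intro i n
    obtain ⟨j, hj⟩ := hx (i + 1) n
    refine ⟨j, hj ▸ block_eq_block_iff.2 fun k _ => ?_⟩
    rw [shift, Nat.add_right_comm]
  · intro Y hY hYv
    refine hYv.antisymm fun x hx => ?_
    obtain ⟨y, hy⟩ := hY.nonempty
    have hshift : ∀ j, shift^[j] y ∈ Y := fun j => by
      induction j with
      | zero => exact hy
      | succ j ih => rw [Function.iterate_succ_apply']; exact hY.shift_mem _ ih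
    have hfac : ∀ n, ∃ j, block x 0 n = block y j n := by
      intro n
      obtain ⟨i, hi⟩ := mem_orbitClosure_iff.1 hx 0 n
      obtain ⟨L, hL⟩ := hv i n
      -- A prefix of `y` of length `L + n` is a factor of `v` long enough to contain the wanted
      -- block.
      obtain ⟨m, hm⟩ := mem_orbitClosure_iff.1 (hYv hy) 0 (L + n)
      obtain ⟨j, hmj, hjL, hj⟩ := hL m
      refine ⟨j - m, ?_⟩
      rw [hi, ← hj]
      rw [block_eq_block_iff] at hm ⊢
      intro k hk
      have := hm (j - m + k) (by omega)
      rw [zero_add] at this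
      rw [this]
      congr 1
      omega
    choose j hj using hfac
    refine hY.isClosed.mem_of_tendsto (f := fun n => shift^[j n] y) (b := Filter.atTop) ?_
      (Filter.Eventually.of_forall fun n => hshift _)
    rw [tendsto_pi_nhds]
    intro k
    refine tendsto_const_nhds.congr' ?_
    filter_upwards [Filter.eventually_gt_atTop k] with n hn
    rw [iterate_shift_apply]
    simpa using block_eq_block_iff.1 (hj n) k hn

/-! ### Balance in the abelian closure and unshuffling -/

theorem HasSlope.balanced_of_mem_abelianClosure {s y : ℕ → Fin 2} {a : ℝ} (hs : HasSlope s a)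
    (ha : Irrational a) (hy : y ∈ abelianClosure s) (j k : ℕ) :
    (letterCount y 1 j : ℝ) - letterCount y 1 k - ((j : ℝ) - k) * a < 1 := by
  rw [mem_abelianClosure_iff] at hy
  rcases le_total k j with h | h
  · obtain ⟨n, rfl⟩ := Nat.exists_eq_add_of_le h
    obtain ⟨i, hi⟩ := hy k n
    have := hs.sub_lt_one ha (i + n) i
    rw [letterCount_add] at this ⊢
    rw [hi.count_eq]
    push_cast at this ⊢
    linarith
  · obtain ⟨n, rfl⟩ := Nat.exists_eq_add_of_le h
    obtain ⟨i, hi⟩ := hy j n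
    have := hs.sub_lt_one ha i (i + n)
    rw [letterCount_add] at this ⊢
    rw [hi.count_eq]
    push_cast at this ⊢
    linarith

/-- A letter occurring finitely often would have a bounded count, against the linear growth forced
by balance and `0 < a < 1`. -/
theorem exists_letterCount_eq_of_balanced {y : ℕ → Fin 2} {a : ℝ} (ha0 : 0 < a) (ha1 : a < 1)
    (hy : ∀ j k, (letterCount y 1 j : ℝ) - letterCount y 1 k - ((j : ℝ) - k) * a < 1)
    (b : Fin 2) (n : ℕ) : ∃ i, letterCount y b i = n ∧ y i = b := by
  have hinf : {n | y n = b}.Infinite := by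
    intro hfin
    have hle : ∀ j, (letterCount y b j : ℝ) ≤ hfin.toFinset.card := fun j => by
      exact_mod_cast Nat.count_le_card hfin j
    have hb : b = 0 ∨ b = 1 := by omega
    rcases hb with rfl | rfl
    · obtain ⟨j, hj⟩ := exists_nat_gt ((1 + hfin.toFinset.card : ℝ) / (1 - a))
      rw [div_lt_iff₀ (by linarith)] at hj
      have h1 := hy j 0
      have h2 : (letterCount y 0 j : ℝ) + letterCount y 1 j = j := by
        exact_mod_cast letterCount_zero_add_one y j
      simp only [letterCount_zero, Nat.cast_zero] at h1
      linarith [hle j]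
    · obtain ⟨j, hj⟩ := exists_nat_gt ((1 + hfin.toFinset.card : ℝ) / a)
      rw [div_lt_iff₀ ha0] at hj
      have h1 := hy 0 j
      simp only [letterCount_zero, Nat.cast_zero] at h1
      linarith [hle j]
  exact ⟨Nat.nth (fun i => y i = b) n, Nat.count_nth_of_infinite hinf n,
    Nat.nth_mem_of_infinite hinf n⟩

theorem mem_abelianClosure_of_count {t z : ℕ → α} {y s : ℕ → Fin 2} {b : Fin 2}
    (hy : Function.Surjective (letterCount y b))
    (h : ∀ i n, ∃ j, (block t (letterCount y b i) ((block y i n).count b)).Perm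
      (block z (letterCount s b j) ((block s j n).count b))) :
    t ∈ abelianClosure z := by
  rw [mem_abelianClosure_iff]
  intro i k
  obtain ⟨i₀, h₀⟩ := hy i
  obtain ⟨i₁, h₁⟩ := hy (i + k)
  rcases le_total i₀ i₁ with hle | hle
  · obtain ⟨n, rfl⟩ := Nat.exists_eq_add_of_le hle
    obtain ⟨j, hj⟩ := h i₀ n
    rw [letterCount_add, h₀] at h₁
    have hk : (block y i₀ n).count b = k := by omega
    have hl := hj.length_eq
    simp only [length_block] at hl
    rw [← hl, hk, h₀] at hj
    exact ⟨_, hj⟩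
  · have := Nat.count_monotone (fun i => y i = b) hle
    change letterCount y b i₁ ≤ letterCount y b i₀ at this
    obtain rfl : k = 0 := by omega
    exact ⟨0, by simp⟩

theorem perm_and_perm_of_append {A : Set α} {P Q P' Q' : List α} (hP : ∀ c ∈ P, c ∈ A)
    (hP' : ∀ c ∈ P', c ∈ A) (hQ : ∀ c ∈ Q, c ∉ A) (hQ' : ∀ c ∈ Q', c ∉ A)
    (h : (P ++ Q).Perm (P' ++ Q')) : P.Perm P' ∧ Q.Perm Q' := by
  classical
  have h1 := h.filter (fun c => decide (c ∈ A))
  have h2 := h.filter (fun c => decide (c ∉ A))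
  have e1 : ∀ {R S : List α}, (∀ c ∈ R, c ∈ A) → (∀ c ∈ S, c ∉ A) →
      (R ++ S).filter (fun c => decide (c ∈ A)) = R := fun hR hS => by
    rw [List.filter_append, List.filter_eq_self.2 (by simpa using hR),
      List.filter_eq_nil_iff.2 (by simpa using hS), List.append_nil]
  have e2 : ∀ {R S : List α}, (∀ c ∈ R, c ∈ A) → (∀ c ∈ S, c ∉ A) →
      (R ++ S).filter (fun c => decide (c ∉ A)) = S := fun hR hS => by
    rw [List.filter_append, List.filter_eq_nil_iff.2 (by simpa using hR),
      List.filter_eq_self.2 (by simpa using hS), List.nil_append]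
  rw [e1 hP hQ, e1 hP' hQ'] at h1
  rw [e2 hP hQ, e2 hP' hQ'] at h2
  exact ⟨h1, h2⟩

/-! ### The two inclusions and the minimal pieces -/

theorem orbitClosure_substitute_subset {s : ℕ → Fin 2} {a : ℝ} (ha : Irrational a)
    (hs : HasSlope s a) {N : ℕ} (hN : 0 < N) {z₀ z₁ t₀ t₁ : ℕ → α}
    (hz₀ : Function.Periodic z₀ N) (hz₁ : Function.Periodic z₁ N)
    (ht₀ : t₀ ∈ abelianClosure z₀) (ht₁ : t₁ ∈ abelianClosure z₁) :
    orbitClosure (substitute s t₀ t₁) ⊆ abelianClosure (substitute s z₀ z₁) := by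
  intro y hy
  rw [mem_orbitClosure_iff] at hy
  rw [mem_abelianClosure_iff] at ht₀ ht₁ ⊢
  intro i₀ n
  obtain ⟨i, hi⟩ := hy i₀ n
  rw [hi]
  obtain ⟨j₀, hj₀⟩ := ht₀ (letterCount s 0 i) ((block s i n).count 0)
  obtain ⟨j₁, hj₁⟩ := ht₁ (letterCount s 1 i) ((block s i n).count 1)
  -- With position `j₀ + j₁` and one-count `j₁` modulo `N`, the zero-count is `j₀`, so both periodic
  -- words are read from the desired places.
  obtain ⟨L, hL⟩ := hs.exists_occurrence ha hN n (fun k => letterCount s 1 (i + k))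
    (fun j _ k _ => by
      have := hs.sub_lt_one ha (i + j) (i + k)
      push_cast at this
      linarith) (j₀ + j₁) j₁
  obtain ⟨j, -, -, hj, hj1, hT⟩ := hL 0
  have hb : block s j n = block s i n := block_eq_of_letterCount hT
  have hj0 : letterCount s 0 j ≡ j₀ [MOD N] := by
    rw [← letterCount_zero_add_one s j] at hj
    exact Nat.ModEq.add_right_cancel hj1 hj
  refine ⟨j, (block_substitute_perm s t₀ t₁ i n).trans ?_⟩
  refine List.Perm.trans ?_ (block_substitute_perm s z₀ z₁ j n).symm
  rw [hb, block_eq_of_modEq hz₀ hj0, block_eq_of_modEq hz₁ hj1]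
  exact hj₀.append hj₁

theorem isMinimalSubshift_orbitClosure_substitute [TopologicalSpace α] [DiscreteTopology α]
    {s : ℕ → Fin 2} {a : ℝ} (ha : Irrational a) (hs : HasSlope s a) {N : ℕ} (hN : 0 < N)
    {t₀ t₁ : ℕ → α} (ht₀ : Function.Periodic t₀ N) (ht₁ : Function.Periodic t₁ N) :
    IsMinimalSubshift (orbitClosure (substitute s t₀ t₁)) := by
  refine isMinimalSubshift_orbitClosure fun i n => ?_
  obtain ⟨L, hL⟩ := hs.exists_occurrence ha hN n (fun k => letterCount s 1 (i + k))
    (fun j _ k _ => by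
      have := hs.sub_lt_one ha (i + j) (i + k)
      push_cast at this
      linarith) i (letterCount s 1 i)
  refine ⟨L, fun m => ?_⟩
  obtain ⟨j, hmj, hjL, hj, hj1, hT⟩ := hL m
  exact ⟨j, hmj, hjL, block_substitute_eq ht₀ ht₁ (block_eq_of_letterCount hT) hj hj1⟩

theorem exists_mem_orbitClosure_substitute {A : Set α} {s : ℕ → Fin 2} {a : ℝ}
    (ha : Irrational a) (ha0 : 0 < a) (ha1 : a < 1) (hs : HasSlope s a) {N : ℕ} (hN : 0 < N)
    {z₀ z₁ y : ℕ → α} (hz₀ : Function.Periodic z₀ N) (hz₁ : Function.Periodic z₁ N)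
    (hA : ∀ n, z₀ n ∈ A) (hB : ∀ n, z₁ n ∉ A)
    (hy : y ∈ abelianClosure (substitute s z₀ z₁)) :
    ∃ t₀ ∈ abelianClosure z₀, ∃ t₁ ∈ abelianClosure z₁, y ∈ orbitClosure (substitute s t₀ t₁) := by
  classical
  rw [mem_abelianClosure_iff] at hy
  -- Projecting to the alphabet index recovers `s` from the substituted word and a skeleton `x` from
  -- `y`.
  let π : α → Fin 2 := fun c => if c ∈ A then 0 else 1
  have hπ : π ∘ substitute s z₀ z₁ = s := by
    funext n
    have hsn : s n = 0 ∨ s n = 1 := by omega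
    rcases hsn with h | h <;> simp [π, substitute, h, hA, hB]
  let x : ℕ → Fin 2 := π ∘ y
  have hx : x ∈ abelianClosure s := by
    rw [mem_abelianClosure_iff]
    intro i n
    obtain ⟨j, hj⟩ := hy i n
    refine ⟨j, ?_⟩
    have := hj.map π
    rwa [map_block, map_block, hπ] at this
  have hbal := hs.balanced_of_mem_abelianClosure ha hx
  choose f hf hfx using exists_letterCount_eq_of_balanced ha0 ha1 hbal
  have hinj : ∀ n, f (x n) (letterCount x (x n) n) = n := fun n =>
    Nat.count_injective (p := fun i => x i = x n) (hfx _ _) rfl (hf _ _)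
  let t₀ : ℕ → α := fun n => y (f 0 n)
  let t₁ : ℕ → α := fun n => y (f 1 n)
  have hyt : substitute x t₀ t₁ = y := by
    funext n
    have h := hinj n
    have hxn : x n = 0 ∨ x n = 1 := by omega
    rcases hxn with h0 | h0 <;> rw [h0] at h
    · rw [substitute, if_pos h0]; exact congrArg y h
    · rw [substitute, if_neg (by simp [h0])]; exact congrArg y h
  have hxA : ∀ n, y n ∈ A ↔ x n = 0 := fun n => by simp [x, π]
  have hA' : ∀ n, t₀ n ∈ A := fun n => (hxA _).2 (hfx 0 n)
  have hB' : ∀ n, t₁ n ∉ A := fun n => by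
    rw [hxA, hfx 1 n]; decide
  have hsplit : ∀ i n, ∃ j,
      (block t₀ (letterCount x 0 i) ((block x i n).count 0)).Perm
        (block z₀ (letterCount s 0 j) ((block s j n).count 0)) ∧
      (block t₁ (letterCount x 1 i) ((block x i n).count 1)).Perm
        (block z₁ (letterCount s 1 j) ((block s j n).count 1)) := by
    intro i n
    obtain ⟨j, hj⟩ := hy i n
    rw [← hyt] at hj
    refine ⟨j, perm_and_perm_of_append (A := A) ?_ ?_ ?_ ?_
      (((block_substitute_perm x t₀ t₁ i n).symm.trans hj).trans
        (block_substitute_perm s z₀ z₁ j n))⟩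
    all_goals
      intro c hc
      obtain ⟨k, -, rfl⟩ := mem_block.1 hc
    exacts [hA' _, hA _, hB' _, hB _]
  have ht₀ : t₀ ∈ abelianClosure z₀ := mem_abelianClosure_of_count (fun n => ⟨_, hf 0 n⟩)
    fun i n => (hsplit i n).imp fun _ h => h.1
  have ht₁ : t₁ ∈ abelianClosure z₁ := mem_abelianClosure_of_count (fun n => ⟨_, hf 1 n⟩)
    fun i n => (hsplit i n).imp fun _ h => h.2
  refine ⟨t₀, ht₀, t₁, ht₁, mem_orbitClosure_iff.2 fun i n => ?_⟩
  -- The skeleton `x` may differ from `s`, but its balanced factors occur in `s` with matching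
  -- residues, so `s` can replace `x`.
  obtain ⟨L, hL⟩ := hs.exists_occurrence ha hN n (fun k => letterCount x 1 (i + k))
    (fun j _ k _ => by
      have := hbal (i + j) (i + k)
      push_cast at this
      linarith) i (letterCount x 1 i)
  obtain ⟨j, -, -, hj, hj1, hT⟩ := hL 0
  refine ⟨j, ?_⟩
  have := block_substitute_eq (periodic_of_mem_abelianClosure hz₀ ht₀)
    (periodic_of_mem_abelianClosure hz₁ ht₁) (block_eq_of_letterCount hT) hj hj1
  rw [this, hyt, Nat.add_zero]

end InfWord

end

theorem mainTheorem2 {α : Type*} [TopologicalSpace α] [DiscreteTopology α]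
    (A B : Set α) (hAB : Disjoint A B)
    (s : ℕ → Fin 2) (hs : InfWord.IsSturmian s)
    (z₀ z₁ : ℕ → α) (hz₀ : InfWord.IsPeriodic z₀) (hz₁ : InfWord.IsPeriodic z₁)
    (hA : ∀ n, z₀ n ∈ A) (hB : ∀ n, z₁ n ∈ B) :
    InfWord.abelianClosure (InfWord.substitute s z₀ z₁) =
        (⋃ t₀ ∈ InfWord.abelianClosure z₀, ⋃ t₁ ∈ InfWord.abelianClosure z₁,
          InfWord.orbitClosure (InfWord.substitute s t₀ t₁)) ∧
      ∃ F : Set (Set (ℕ → α)), F.Finite ∧ (∀ X ∈ F, InfWord.IsMinimalSubshift X) ∧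
        InfWord.abelianClosure (InfWord.substitute s z₀ z₁) = ⋃₀ F := by
  obtain ⟨a, ha, ha0, ha1, hsa⟩ := hs.exists_hasSlope
  obtain ⟨p, hp, hz₀⟩ := hz₀
  obtain ⟨q, hq, hz₁⟩ := hz₁
  have hN : 0 < q * p := Nat.mul_pos hq hp
  have hz₀' : Function.Periodic z₀ (q * p) := hz₀.nat_mul q
  have hz₁' : Function.Periodic z₁ (q * p) := by
    rw [mul_comm]; exact hz₁.nat_mul p
  have hB' : ∀ n, z₁ n ∉ A := fun n h => Set.disjoint_left.1 hAB h (hB n)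
  have hunion : InfWord.abelianClosure (InfWord.substitute s z₀ z₁) =
      ⋃ t₀ ∈ InfWord.abelianClosure z₀, ⋃ t₁ ∈ InfWord.abelianClosure z₁,
        InfWord.orbitClosure (InfWord.substitute s t₀ t₁) := by
    ext y
    simp only [Set.mem_iUnion, exists_prop]
    constructor
    · exact InfWord.exists_mem_orbitClosure_substitute ha ha0 ha1 hsa hN hz₀' hz₁' hA hB'
    · rintro ⟨t₀, ht₀, t₁, ht₁, hy⟩
      exact InfWord.orbitClosure_substitute_subset ha hsa hN hz₀' hz₁' ht₀ ht₁ hy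
  refine ⟨hunion, Set.image2 (fun t₀ t₁ => InfWord.orbitClosure (InfWord.substitute s t₀ t₁))
    (InfWord.abelianClosure z₀) (InfWord.abelianClosure z₁),
    (InfWord.finite_abelianClosure hN hz₀').image2 _ (InfWord.finite_abelianClosure hN hz₁'),
    ?_, ?_⟩
  · rintro _ ⟨t₀, ht₀, t₁, ht₁, rfl⟩
    exact InfWord.isMinimalSubshift_orbitClosure_substitute ha hsa hN
      (InfWord.periodic_of_mem_abelianClosure hz₀' ht₀)
      (InfWord.periodic_of_mem_abelianClosure hz₁' ht₁)
  · rw [hunion]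
    ext y
    simp only [Set.mem_iUnion, exists_prop, Set.mem_sUnion, Set.exists_mem_image2]
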